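/- Let $\mathbb{D}_{nd}$ be nondecreasing Hechler forcing: its conditions are the pairs $\langle s,f\rangle$ with $s$ a finite nondecreasing sequence of natural numbers and $f\in\omega^\omega$, and $\langle s',f'\rangle\le\langle s,f\rangle$ if and only if $s\subseteq s'$, $f(n)\le f'(n)$ for all $n$, and $f(n)\le s'(n)$ for all $n$ with $|s|\le n<|s'|$. Let $d$ be a $\mathbb{D}_{nd}$-generic real over $V$, that is, the union of the stems $s$ of the conditions $\langle s,f\rangle$ in a $\mathbb{D}_{nd}$-generic filter over $V$. For $x,y\in\omega^\omega$ write $x\le^* y$ if $x(n)\le y(n)$ for all but finitely many $n$; a real $y\in\omega^\omega\cap V[d]$ is dominating if $f\le^* y$ for every $f\in\omega^\omega\cap V$. Then $d$ is a dominating real, and for every dominating real $y\in\omega^\omega\cap V[d]$ there are nondecreasing functions $z_0,z_1\colon\omega\to\omega$ in $V$, both tending to infinity, such that $z_0\circ d\circ z_1\le^* y$. In other words, with $x\preceq y$ meaning that $z_0\circ x\circ z_1\le^* y$ for some such $z_0,z_1\in V$, the real $d$ is $\preceq$-least among the dominating reals of $V[d]$. -/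

import Mathlib

/-! Forcing over the universe `V` of sets (well-founded sets are represented by Mathlib's `PSet`).
For a notion of forcing `P` (smaller means stronger, `⊤` is the trivial condition), the extension is
described by all `P`-names and by the forcing relation. A statement holds in every extension `V[G]`,
`G` a `P`-generic filter over `V`, exactly when every condition forces it. -/

universe u v

namespace Forcing

/-- `P`-names: sets of pairs of a name and a condition, defined by recursion. -/
inductive Name (P : Type v) : Type (max (u + 1) v)
  | mk (ι : Type u) (elt : ι → Name P) (cond : ι → P) : Name P

/-- A statement of the forcing language, given by the set of the conditions that force it. -/
def Sentence (P : Type v) : Type v := P → Prop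

/-- `p ⊩ φ`: the condition `p` forces `φ`. -/
def Forces {P : Type v} (p : P) (φ : Sentence P) : Prop := φ p

infix:20 " ⊩ " => Forces

section Language

variable {P : Type v} [Preorder P]

/-- The set `D` is dense below the condition `p`. -/
def DenseBelow (p : P) (D : P → Prop) : Prop := ∀ q ≤ p, ∃ r ≤ q, D r

/-- `x = y`: every element that `x` acquires is forced to be in `y`, and conversely. -/
def eqN : Name.{u} P → Name.{u} P → Sentence P
  | .mk _ x s, .mk _ y t => fun p =>
      (∀ i, ∀ q ≤ p, q ≤ s i → DenseBelow q fun r => ∃ j, r ≤ t j ∧ eqN (x i) (y j) r) ∧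
      (∀ j, ∀ q ≤ p, q ≤ t j → DenseBelow q fun r => ∃ i, r ≤ s i ∧ eqN (x i) (y j) r)

/-- `x ∈ y`. -/
def memN (x : Name.{u} P) : Name.{u} P → Sentence P
  | .mk _ y t => fun p => DenseBelow p fun r => ∃ j, r ≤ t j ∧ eqN x (y j) r

/-- Conjunction. -/
def andN (φ ψ : Sentence P) : Sentence P := fun p => (p ⊩ φ) ∧ (p ⊩ ψ)

/-- Disjunction. -/
def orN (φ ψ : Sentence P) : Sentence P := fun p => DenseBelow p fun q => (q ⊩ φ) ∨ (q ⊩ ψ)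

/-- Implication. -/
def impN (φ ψ : Sentence P) : Sentence P := fun p => ∀ q ≤ p, (q ⊩ φ) → (q ⊩ ψ)

/-- Universal quantification over all names. -/
def allN (φ : Name.{u} P → Sentence P) : Sentence P := fun p => ∀ x, p ⊩ φ x

/-- Existential quantification over all names. -/
def exN (φ : Name.{u} P → Sentence P) : Sentence P := fun p => DenseBelow p fun q => ∃ x, q ⊩ φ x

infix:50 " =ₙ " => eqN
infix:50 " ∈ₙ " => memN
infixr:35 " ∧ₙ " => andN
infixr:30 " ∨ₙ " => orN
infixr:25 " →ₙ " => impN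

/-- `∀ x ∈ a, φ x`. -/
def allIn (a : Name.{u} P) (φ : Name.{u} P → Sentence P) : Sentence P :=
  allN fun x => x ∈ₙ a →ₙ φ x

/-- `∃ x ∈ a, φ x`. -/
def exIn (a : Name.{u} P) (φ : Name.{u} P → Sentence P) : Sentence P :=
  exN fun x => x ∈ₙ a ∧ₙ φ x

variable [OrderTop P]

/-- The canonical name of a set of the ground model. -/
def check : PSet.{u} → Name.{u} P
  | .mk ι x => .mk ι (fun i => check (x i)) fun _ => ⊤

/-- A name of the unordered pair `{x, y}`. -/
def upair (x y : Name.{u} P) : Name.{u} P :=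
  .mk (ULift.{u} Bool) (fun b => if b.down then x else y) fun _ => ⊤

/-- A name of the Kuratowski ordered pair `(x, y) = {{x}, {x, y}}`. -/
def opair (x y : Name.{u} P) : Name.{u} P := upair (upair x x) (upair x y)

/-- The canonical name of the set of natural numbers. -/
def omega : Name.{u} P := check PSet.omega.{u}

/-- `y` is a function from `ω` to `ω`. -/
def isReal (y : Name.{u} P) : Sentence P :=
  (allIn y fun z => exIn omega fun n => exIn omega fun m => z =ₙ opair n m) ∧ₙ
  (allIn omega fun n => exIn omega fun m => opair n m ∈ₙ y) ∧ₙ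
  (allIn omega fun n => allIn omega fun m => allIn omega fun m' =>
    opair n m ∈ₙ y →ₙ opair n m' ∈ₙ y →ₙ m =ₙ m')

/-- The relation `y(n) = m`. -/
def graph (y : Name.{u} P) (n m : Name.{u} P) : Sentence P := opair n m ∈ₙ y

/-- The relation `(R ∘ S)(n) = m`, for `R` and `S` the graphs of functions. -/
def comp (R S : Name.{u} P → Name.{u} P → Sentence P) (n m : Name.{u} P) : Sentence P :=
  exIn omega fun k => S n k ∧ₙ R k m

/-- The order of the natural numbers, as von Neumann ordinals. -/
def leN (n m : Name.{u} P) : Sentence P := n ∈ₙ m ∨ₙ n =ₙ m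

/-- `R ≤* S`, for `R` and `S` the graphs of functions from `ω` to `ω`:
`R(n) ≤ S(n)` for all but finitely many `n`. -/
def leStar (R S : Name.{u} P → Name.{u} P → Sentence P) : Sentence P :=
  exIn omega fun N => allIn omega fun n => leN N n →ₙ
    exIn omega fun a => exIn omega fun b => R n a ∧ₙ S n b ∧ₙ leN a b

end Language

/-- The ordered pair `(x, y) = {{x}, {x, y}}` in the ground model. -/
def groundPair (x y : PSet.{u}) : PSet.{u} := {{x}, {x, y}}

/-- The function `f : ω → ω` as a set of the ground model. -/
def groundGraph (f : ℕ → ℕ) : PSet.{u} :=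
  .mk (ULift.{u} ℕ) fun n => groundPair (PSet.ofNat n.down) (PSet.ofNat (f n.down))

/-- A set of functions `ω → ω` as a set of the ground model. -/
def groundSet (S : Set (ℕ → ℕ)) : PSet.{u} :=
  .mk (ULift.{u} S) fun f => groundGraph f.down.1

/-- The nondecreasing functions from `ω` to `ω` that tend to infinity. -/
def Climbing : Set (ℕ → ℕ) := {z | Monotone z ∧ Filter.Tendsto z Filter.atTop Filter.atTop}

section Dominating

variable {P : Type v} [Preorder P] [OrderTop P]

/-- `y` is a dominating real: `y ∈ ω^ω`, and `f ≤* y` for all `f ∈ V ∩ ω^ω`. -/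
def isDominating (y : Name.{u} P) : Sentence P :=
  isReal y ∧ₙ allIn (check (groundSet Set.univ)) fun f => leStar (graph f) (graph y)

/-- `x ⪯ y`: there are `z₀, z₁ ∈ V`, nondecreasing functions from `ω` to `ω` that tend to
infinity, with `z₀ ∘ x ∘ z₁ ≤* y`. -/
def precN (x y : Name.{u} P) : Sentence P :=
  exIn (check (groundSet Climbing)) fun z₀ => exIn (check (groundSet Climbing)) fun z₁ =>
    leStar (comp (graph z₀) (comp (graph x) (graph z₁))) (graph y)

end Dominating

/-- Conditions of nondecreasing Hechler forcing: a nondecreasing finite sequence of natural numbers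
(the stem) and a function from `ω` to `ω` (the commitment). -/
@[ext] structure Dnd where
  stem : List ℕ
  nondecreasing : stem.Pairwise (· ≤ ·)
  commitment : ℕ → ℕ

/-- `q ≤ p`: the stem of `q` extends that of `p`, its commitment is pointwise at least that of `p`,
and the new values of the stem obey the commitment of `p`. -/
instance : PartialOrder Dnd where
  le q p := p.stem <+: q.stem ∧ (∀ n, p.commitment n ≤ q.commitment n) ∧
    ∀ n (h : n < q.stem.length), p.stem.length ≤ n → p.commitment n ≤ q.stem[n]
  le_refl p := ⟨List.prefix_rfl, fun _ => le_rfl, fun _ h h' => absurd h (not_lt.2 h')⟩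
  le_trans r q p hrq hqp := by
    refine ⟨hqp.1.trans hrq.1, fun n => (hqp.2.1 n).trans (hrq.2.1 n), fun n h hn => ?_⟩
    by_cases hq : n < q.stem.length
    · rw [← hrq.1.getElem hq]
      exact hqp.2.2 n hq hn
    · exact (hqp.2.1 n).trans (hrq.2.2 n h (not_lt.1 hq))
  le_antisymm q p hqp hpq := by
    refine Dnd.ext ?_ (funext fun n => le_antisymm (hpq.2.1 n) (hqp.2.1 n))
    exact hpq.1.eq_of_length (le_antisymm hpq.1.length_le hqp.1.length_le)

instance : OrderTop Dnd where
  top := ⟨[], List.Pairwise.nil, fun _ => 0⟩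
  le_top _ := ⟨List.nil_prefix, fun _ => Nat.zero_le _, fun _ _ _ => Nat.zero_le _⟩

/-- The canonical name of the generic real `d`, the union of the stems of the conditions in the
generic filter: the name consists of all pairs `((n, m)ˇ, p)` such that the stem of `p` takes the
value `m` at `n`. -/
def hechlerReal : Name.{u} Dnd :=
  .mk (ULift.{u} {x : ℕ × ℕ × Dnd // x.2.2.stem[x.1]? = some x.2.1})
    (fun x => check (groundPair (PSet.ofNat x.down.1.1) (PSet.ofNat x.down.1.2.1)))
    fun x => x.down.1.2.2

end Forcing

open Forcing

/-!
The proof consists of a combinatorial statement about conditions and its translation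
through the forcing relation.

For a name `y` of a dominating real, let `R q n m` say that `q` forces `m ≤ y(n)`, and call a stem
`s` *unbounded at `n`* (`Unbounded`) if for every `m` some condition with stem `s` forces
`m ≤ y(n)`. If `s` is not unbounded at `n`, then some `b` is such that no condition with stem `s`
forces `b ≤ y(n)`. As there are countably many stems, a function `g` of the ground model can exceed
these bounds for finitely many selected stems at each `n`; once a condition `q` forces `g ≤ y` from
some point on, no selected stem compatible with `q` puts a bound on `y(n)`.

The selection makes this strong (`exists_eventually_unbounded`): for a stem `t`, a length `j` and a
number `n`, it picks among the `j`-step extensions of `t` that are bounded at `n` one whose first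
new value is as large as possible, up to `n`. If for infinitely many `n` these first values were
beyond the commitment of `q`, then so would be the later ones, because stems are nondecreasing, and
a selected stem would be compatible with `q`. Hence for large `n` the first values of the bounded
extensions lie below a fixed number, and induction on `j` applies to each of these values. So for
every `k` all stems below `q` of length at most `k` are unbounded at all large `n`.

Now let `z₁` grow so slowly that all stems below `q` of length at most `z₁(n) + 1` are unbounded at
`n` (`exists_climbing_bound`). Let `M = s(z₁(n))` be the value of a stem `s` below `q`, and
`m = z₀(M)` with `z₀` growing very slowly. Take levels `L₀ ≤ L₁ ≤ ⋯` up to at most `M`, where `Lᵢ₊₁`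
exceeds the relevant commitments that force `m ≤ y(n)` together with stems having values up to `Lᵢ`.
The new values of `s` cannot stay below successive levels all the way to `M`, so one of them is the
first to be at least `Lᵢ₊₁` after a part `t` of `s` with values up to `Lᵢ`. This `t` is unbounded at
`n`, and the rest of `s` obeys the commitment that forces `m ≤ y(n)` together with `t`: at early
positions because `s` is nondecreasing, at the late ones because a fast growing commitment was fixed
in advance. So `s` is compatible with `z₀(d(z₁(n))) ≤ y(n)`.

On the side of the forcing relation, equality of names is a congruence, canonical names are absolute
(`eqN_check`, `memN_check`), and `leStar_iff` reduces `≤*` to natural numbers of the ground model.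
-/

namespace Forcing

/-! ### Slow inverses and finite bounds -/

/-- The slow inverse of `N`: the largest `k ≤ n` with `N k ≤ n` (and `0` if there is none). -/
def slowInverse (N : ℕ → ℕ) (n : ℕ) : ℕ := Nat.findGreatest (fun k => N k ≤ n) n

lemma le_slowInverse {N : ℕ → ℕ} {k n : ℕ} (hk : k ≤ n) (h : N k ≤ n) : k ≤ slowInverse N n :=
  Nat.le_findGreatest hk h

lemma slowInverse_le (N : ℕ → ℕ) (n : ℕ) : slowInverse N n ≤ n := Nat.findGreatest_le n

lemma apply_slowInverse_le {N : ℕ → ℕ} {n : ℕ} (h : N 0 ≤ n) : N (slowInverse N n) ≤ n :=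
  Nat.findGreatest_spec (P := fun k => N k ≤ n) (Nat.zero_le n) h

lemma slowInverse_climbing (N : ℕ → ℕ) : slowInverse N ∈ Climbing := by
  have hmono : Monotone (slowInverse N) := fun a b hab =>
    Nat.findGreatest_mono (fun _ h => le_trans h hab) hab
  refine ⟨hmono, Filter.tendsto_atTop_atTop.2 fun b => ⟨max b (N b), fun a ha => ?_⟩⟩
  exact le_slowInverse ((le_max_left _ _).trans ha) ((le_max_right _ _).trans ha)

/-- The lists of length at most `l` whose entries are at most `L`. -/
def boundedLists (l L : ℕ) : Set (List ℕ) := {s | s.length ≤ l ∧ ∀ x ∈ s, x ≤ L}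

lemma finite_boundedLists (l L : ℕ) : (boundedLists l L).Finite := by
  refine ((List.finite_length_le (Fin (L + 1)) l).image (List.map Fin.val)).subset ?_
  rintro s ⟨hl, hL⟩
  refine ⟨s.pmap (fun x h => ⟨x, h⟩) fun x hx => Nat.lt_succ_of_le (hL x hx), ?_, ?_⟩
  · simpa using hl
  · simp [List.map_pmap]

lemma exists_bound {α : Type*} {S : Set α} (hS : S.Finite) (φ : α → ℕ) :
    ∃ b, ∀ a ∈ S, φ a ≤ b := by
  obtain ⟨b, hb⟩ := (hS.image φ).bddAbove
  exact ⟨b, fun a ha => hb ⟨a, ha, rfl⟩⟩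

lemma headD_le_getElem {l : List ℕ} (hl : l.Pairwise (· ≤ ·)) (i : ℕ) (hi : i < l.length) :
    l.headD 0 ≤ l[i] := by
  rcases l with _ | ⟨a, l⟩
  · simp at hi
  · rcases i with _ | i
    · exact le_rfl
    · exact (List.pairwise_cons.1 hl).1 _ (List.getElem_mem _)

/-! ### Stems below a condition -/

namespace Dnd

/-- The condition with the stem of `p` and the commitment of `p` raised to `p.commitment ⊔ f`. -/
def raise (p : Dnd) (f : ℕ → ℕ) : Dnd := ⟨p.stem, p.nondecreasing, p.commitment ⊔ f⟩

lemma raise_le (p : Dnd) (f : ℕ → ℕ) : p.raise f ≤ p :=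
  ⟨List.prefix_rfl, fun _ => le_max_left _ _, fun _ h h' => absurd h (not_lt.2 h')⟩

lemma raise_le_of_stem {p q : Dnd} (h : q.stem <+: p.stem)
    (hc : ∀ n (hn : n < p.stem.length), q.stem.length ≤ n → q.commitment n ≤ p.stem[n]) :
    p.raise q.commitment ≤ q :=
  ⟨h, fun _ => le_max_right _ _, hc⟩

/-- `s` is the stem of a condition below `q`. -/
def StemBelow (q : Dnd) (s : List ℕ) : Prop :=
  s.Pairwise (· ≤ ·) ∧ q.stem <+: s ∧
    ∀ n (h : n < s.length), q.stem.length ≤ n → q.commitment n ≤ s[n]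

lemma stemBelow_of_le {p q : Dnd} (h : p ≤ q) : q.StemBelow p.stem := ⟨p.nondecreasing, h.1, h.2.2⟩

lemma StemBelow.exists_le {q : Dnd} {s : List ℕ} (h : q.StemBelow s) :
    ∃ r ≤ q, r.stem = s :=
  ⟨⟨s, h.1, q.commitment⟩, ⟨h.2.1, fun _ => le_rfl, h.2.2⟩, rfl⟩

lemma StemBelow.of_prefix {q : Dnd} {s t : List ℕ} (h : q.StemBelow s) (hqt : q.stem <+: t)
    (hts : t <+: s) : q.StemBelow t := by
  refine ⟨h.1.sublist hts.sublist, hqt, fun n hn hqn => ?_⟩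
  rw [hts.getElem hn]
  exact h.2.2 n (hn.trans_le hts.length_le) hqn

end Dnd

/-! ### The combinatorial core -/

section Core

variable (R : Dnd → ℕ → ℕ → Prop)

/-- For `R q n m` meaning that `q` forces `m ≤ y(n)`: each lower bound `m` of `y(n)` is forced by
some condition with the stem `s`. -/
def Unbounded (s : List ℕ) (n : ℕ) : Prop := ∀ m, ∃ q : Dnd, q.stem = s ∧ R q n m

/-- The lists of `j` values that extend the stem `t` to a stem which is not unbounded at `n`. -/
def boundingExtensions (t : List ℕ) (j n : ℕ) : Set (List ℕ) :=
  {e | e.length = j ∧ (t ++ e).Pairwise (· ≤ ·) ∧ ¬ Unbounded R (t ++ e) n}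

/-- Among the bounding extensions there is one whose first value, truncated at `n`, is maximal. -/
lemma exists_maximal_boundingExtension (t : List ℕ) (j n : ℕ)
    (h : (boundingExtensions R t j n).Nonempty) :
    ∃ e ∈ boundingExtensions R t j n, ∀ e' ∈ boundingExtensions R t j n,
      min (e'.headD 0) n ≤ min (e.headD 0) n := by
  have hfin : ((fun e : List ℕ => min (e.headD 0) n) '' boundingExtensions R t j n).Finite :=
    (Set.finite_Iic n).subset (by rintro _ ⟨e, -, rfl⟩; exact Nat.min_le_right _ _)
  obtain ⟨_, ⟨e, he, rfl⟩, hmax⟩ := hfin.exists_maximal (h.image _)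
  dsimp only at hmax
  refine ⟨e, he, fun e' he' => ?_⟩
  rcases le_total (min (e'.headD 0) n) (min (e.headD 0) n) with hle | hle
  · exact hle
  · exact hmax ⟨e', he', rfl⟩ hle

variable {R}

/-- If `R` says that `y` is a dominating real, then below some condition `q` each fixed number of
further values of the stem leaves `y(n)` unbounded, for all large `n` simultaneously. -/
lemma exists_eventually_unbounded
    (hR : ∀ {q q' : Dnd} {n m m' : ℕ}, q' ≤ q → m' ≤ m → R q n m → R q' n m') (p : Dnd)
    (hdom : ∀ g : ℕ → ℕ, ∃ q ≤ p, ∃ N, ∀ n ≥ N, R q n (g n)) :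
    ∃ q ≤ p, ∀ j t, q.StemBelow t → ∃ N, ∀ n ≥ N, ∀ e : List ℕ, e.length = j →
      q.StemBelow (t ++ e) → Unbounded R (t ++ e) n := by
  classical
  have hE : ∀ t j n, ∃ e, (boundingExtensions R t j n).Nonempty → e ∈ boundingExtensions R t j n ∧
      ∀ e' ∈ boundingExtensions R t j n, min (e'.headD 0) n ≤ min (e.headD 0) n := by
    intro t j n
    by_cases h : (boundingExtensions R t j n).Nonempty
    · obtain ⟨e, he⟩ := exists_maximal_boundingExtension R t j n h
      exact ⟨e, fun _ => he⟩
    · exact ⟨[], fun h' => absurd h' h⟩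
  choose E hE using hE
  have hb : ∀ s n, ∃ m, ¬ Unbounded R s n → ∀ q : Dnd, q.stem = s → ¬ R q n m := by
    intro s n
    by_cases h : Unbounded R s n
    · exact ⟨0, fun h' => absurd h h'⟩
    · obtain ⟨m, hm⟩ := not_forall.1 h
      exact ⟨m, fun _ q hq hqm => hm ⟨q, hq, hqm⟩⟩
  choose b hb using hb
  -- `g(n)` exceeds the bounds on `y(n)` put by the selected extensions of the first `n` stems
  have hg : ∀ n, ∃ v, ∀ c : List ℕ × ℕ, Encodable.encode c ≤ n → b (c.1 ++ E c.1 c.2 n) n ≤ v := by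
    intro n
    have hfin : {c : List ℕ × ℕ | Encodable.encode c ≤ n}.Finite :=
      (Set.finite_Iic n).preimage Encodable.encode_injective.injOn
    exact exists_bound hfin fun c => b (c.1 ++ E c.1 c.2 n) n
  choose g hg using hg
  obtain ⟨q, hqp, N, hN⟩ := hdom g
  have key : ∀ t j n, Encodable.encode (t, j) ≤ n → N ≤ n → q.StemBelow (t ++ E t j n) →
      Unbounded R (t ++ E t j n) n := by
    intro t j n hc hn hs
    by_contra hbad
    obtain ⟨r, hr, hrs⟩ := hs.exists_le
    exact hb _ n hbad r hrs (hR hr (hg n (t, j) hc) (hN n hn))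
  refine ⟨q, hqp, fun j => ?_⟩
  induction j with
  | zero =>
    intro t ht
    refine ⟨max N (Encodable.encode (t, 0)), fun n hn e he _ => ?_⟩
    obtain rfl := List.length_eq_zero_iff.1 he
    rw [List.append_nil]
    by_contra hbad
    obtain ⟨⟨h0, -, hu⟩, -⟩ := hE t 0 n ⟨[], rfl, by simpa using ht.1, by simpa using hbad⟩
    refine hu (key t 0 n (le_trans (le_max_right _ _) hn) (le_trans (le_max_left _ _) hn) ?_)
    rw [List.length_eq_zero_iff.1 h0, List.append_nil]
    exact ht
  | succ j ih =>
    intro t ht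
    obtain ⟨X, hX⟩ := exists_bound (Set.finite_Iio (t.length + (j + 1))) q.commitment
    have hsucc : ∀ x, ∃ M, q.StemBelow (t ++ [x]) → ∀ n ≥ M, ∀ e : List ℕ, e.length = j →
        q.StemBelow (t ++ [x] ++ e) → Unbounded R (t ++ [x] ++ e) n := by
      intro x
      by_cases h : q.StemBelow (t ++ [x])
      · obtain ⟨M, hM⟩ := ih _ h
        exact ⟨M, fun _ => hM⟩
      · exact ⟨0, fun h' => absurd h' h⟩
    choose M hM using hsucc
    obtain ⟨M', hM'⟩ := exists_bound (Set.finite_Iio X) M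
    refine ⟨max (max N (Encodable.encode (t, j + 1))) (max X M'), fun n hn e he hte => ?_⟩
    have hnN : N ≤ n := le_trans (le_trans (le_max_left _ _) (le_max_left _ _)) hn
    have hnc : Encodable.encode (t, j + 1) ≤ n :=
      le_trans (le_trans (le_max_right _ _) (le_max_left _ _)) hn
    have hnX : X ≤ n := le_trans (le_trans (le_max_left _ _) (le_max_right _ _)) hn
    have hnM : M' ≤ n := le_trans (le_trans (le_max_right _ _) (le_max_right _ _)) hn
    by_contra hbad
    have hmem : e ∈ boundingExtensions R t (j + 1) n := ⟨he, hte.1, hbad⟩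
    obtain ⟨⟨hl, hsort, hu⟩, hmax⟩ := hE t (j + 1) n ⟨e, hmem⟩
    have hmax := hmax e hmem
    -- a selected extension with a large first value would obey the commitment of `q`
    have hsmall : (E t (j + 1) n).headD 0 < X := by
      by_contra hlarge
      refine hu (key t (j + 1) n hnc hnN ⟨hsort, ht.2.1.trans (List.prefix_append _ _), ?_⟩)
      intro i hi hqi
      by_cases hit : i < t.length
      · rw [List.getElem_append_left hit]
        exact ht.2.2 i hit hqi
      · rw [List.length_append, hl] at hi
        rw [List.getElem_append_right (not_lt.1 hit)]
        refine (hX i hi).trans ((not_lt.1 hlarge).trans ?_)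
        exact headD_le_getElem (List.pairwise_append.1 hsort).2.1 _ _
    rcases e with _ | ⟨x, e⟩
    · simp at he
    · rw [List.headD_cons] at hmax
      have hx : x < X := by
        omega
      have happ : t ++ x :: e = t ++ [x] ++ e := by simp
      rw [happ] at hte hbad
      have htx : q.StemBelow (t ++ [x]) :=
        hte.of_prefix (ht.2.1.trans (List.prefix_append _ _)) (List.prefix_append _ _)
      exact hbad (hM x htx n ((hM' x hx).trans hnM) e (by simpa using he) hte)

/-- If `R` says that `y` is a dominating real, then there are `z₀` and `z₁` such that for all large
`n`, every condition below some `q` whose stem `s` has a value at `z₁ n` is compatible with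
`z₀ (s (z₁ n)) ≤ y(n)`. -/
theorem exists_climbing_bound {R : Dnd → ℕ → ℕ → Prop}
    (hR : ∀ {q q' : Dnd} {n m m' : ℕ}, q' ≤ q → m' ≤ m → R q n m → R q' n m') (p : Dnd)
    (hdom : ∀ g : ℕ → ℕ, ∃ q ≤ p, ∃ N, ∀ n ≥ N, R q n (g n)) :
    ∃ q ≤ p, ∃ z₀ ∈ Climbing, ∃ z₁ ∈ Climbing, ∃ N, ∀ n ≥ N, ∀ r ≤ q,
      ∀ h : z₁ n < r.stem.length, ∃ r' ≤ r, R r' n (z₀ r.stem[z₁ n]) := by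
  classical
  obtain ⟨q, hqp, hq⟩ := exists_eventually_unbounded (R := R) hR p hdom
  have hqs : q.StemBelow q.stem := Dnd.stemBelow_of_le le_rfl
  have hU : ∀ k, ∃ N, ∀ n ≥ N, ∀ s : List ℕ, q.StemBelow s → s.length ≤ k →
      Unbounded R s n := by
    intro k
    choose M hM using fun j => hq j q.stem hqs
    obtain ⟨N, hN⟩ := exists_bound (Set.finite_Iic k) M
    refine ⟨N, fun n hn s hs hsk => ?_⟩
    obtain ⟨e, rfl⟩ := hs.2.1
    refine hM e.length n ((hN _ ?_).trans hn) e rfl hs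
    rw [List.length_append] at hsk
    exact le_trans (Nat.le_add_left _ _) hsk
  choose U hU using hU
  -- `F s n m` is a condition with the stem `s` that forces `m ≤ y(n)`
  have hF : ∀ (s : List ℕ) (n m : ℕ), ∃ F : Dnd, Unbounded R s n → F.stem = s ∧ R F n m := by
    intro s n m
    by_cases h : Unbounded R s n
    · obtain ⟨F, hF⟩ := h m
      exact ⟨F, fun _ => hF⟩
    · exact ⟨⊤, fun h' => absurd h' h⟩
  choose F hF using hF
  -- beyond position `m + L` the commitment `f` below takes over
  have hG : ∀ m L, ∃ v, ∀ s ∈ boundedLists (m + 1) L, ∀ n ≤ m, ∀ i ≤ m + L,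
      (F s n m).commitment i ≤ v := by
    intro m L
    obtain ⟨v, hv⟩ := exists_bound ((finite_boundedLists (m + 1) L).prod
      ((Set.finite_Iic m).prod (Set.finite_Iic (m + L)))) fun c => (F c.1 c.2.1 m).commitment c.2.2
    exact ⟨v, fun s hs n hn i hi => hv (s, n, i) ⟨hs, hn, hi⟩⟩
  choose G hG using hG
  obtain ⟨A, hA⟩ := exists_bound q.stem.toFinset.finite_toSet id
  -- `level m i` bounds the first `i` new values of a stem until one of them jumps over its level
  let level : ℕ → ℕ → ℕ := fun m i => Nat.rec A (fun _ L => max L (G m L)) i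
  have hlevel : ∀ m i, level m (i + 1) = max (level m i) (G m (level m i)) := fun _ _ => rfl
  have hlevelMono : ∀ m, Monotone (level m) := fun m =>
    monotone_nat_of_le_succ fun i => by rw [hlevel]; exact le_max_left _ _
  let Λ : ℕ → ℕ := fun m => level m (m + 1)
  let z₀ := slowInverse Λ
  let z₁ := slowInverse fun k => U (k + 1)
  have hz₁ : z₁ ∈ Climbing := slowInverse_climbing _
  -- the commitment `f` of the final condition: besides the late positions it makes `z₀ (d (z₁ n))`
  -- at least `n`, so that the levels for `m = z₀ (d (z₁ n))` take care of `n`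
  have hf : ∀ i, ∃ v, q.commitment i ≤ v ∧ Λ 0 ≤ v ∧ (∀ n, z₁ n ≤ i → n ≤ v ∧ Λ n ≤ v) ∧
      ∀ s ∈ boundedLists i i, ∀ n ≤ i, ∀ m ≤ i, (F s n m).commitment i ≤ v := by
    intro i
    obtain ⟨c, hc⟩ := Filter.tendsto_atTop_atTop.1 hz₁.2 (i + 1)
    obtain ⟨v₁, hv₁⟩ := exists_bound (Set.finite_Iic c) Λ
    obtain ⟨v₂, hv₂⟩ := exists_bound ((finite_boundedLists i i).prod
      ((Set.finite_Iic i).prod (Set.finite_Iic i))) fun a => (F a.1 a.2.1 a.2.2).commitment i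
    refine ⟨q.commitment i + Λ 0 + c + v₁ + v₂, by omega, by omega, fun n hn => ?_,
      fun s hs n hn m hm => ?_⟩
    · have hnc : n ≤ c := by
        by_contra h
        have := hc n (by omega)
        omega
      have := hv₁ n hnc
      omega
    · have : (F s n m).commitment i ≤ v₂ := hv₂ (s, n, m) ⟨hs, hn, hm⟩
      omega
  choose f hfq hfΛ hfz hfF using hf
  obtain ⟨N, hN⟩ := Filter.tendsto_atTop_atTop.1 hz₁.2 q.stem.length
  have hle : (⟨q.stem, q.nondecreasing, f⟩ : Dnd) ≤ q :=
    ⟨List.prefix_rfl, hfq, fun n h h' => absurd h (not_lt.2 h')⟩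
  refine ⟨⟨q.stem, q.nondecreasing, f⟩, hle.trans hqp, z₀, slowInverse_climbing _, z₁, hz₁,
    max N (U 1), fun n hn r hr hk => ?_⟩
  have hrf : ∀ i (h : i < r.stem.length), q.stem.length ≤ i → f i ≤ r.stem[i] := hr.2.2
  have hrq : q.StemBelow r.stem :=
    ⟨r.nondecreasing, hr.1, fun i h h' => (hfq i).trans (hrf i h h')⟩
  have hsorted : ∀ i j (hj : j < r.stem.length) (hij : i ≤ j), r.stem[i] ≤ r.stem[j] :=
    fun i j hj hij => r.nondecreasing.rel_get_of_le (a := ⟨i, hij.trans_lt hj⟩) (b := ⟨j, hj⟩) hij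
  have hqk : q.stem.length ≤ z₁ n := hN n ((le_max_left _ _).trans hn)
  have hUk : U (z₁ n + 1) ≤ n :=
    apply_slowInverse_le (N := fun k => U (k + 1)) ((le_max_right _ _).trans hn)
  have hkn : z₁ n ≤ n := slowInverse_le _ _
  have hkf := hfz (z₁ n) n le_rfl
  have hMf := hrf (z₁ n) hk hqk
  have hnm : n ≤ z₀ r.stem[z₁ n] := le_slowInverse (hkf.1.trans hMf) (hkf.2.trans hMf)
  have hΛM : Λ (z₀ r.stem[z₁ n]) ≤ r.stem[z₁ n] := apply_slowInverse_le ((hfΛ _).trans hMf)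
  generalize z₀ r.stem[z₁ n] = m at hnm hΛM ⊢
  -- the value at `z₁ n` is above the levels, so some value of the stem is the first to
  -- jump over the level assigned to its position
  let P : ℕ → Prop := fun i => ∃ h : q.stem.length + i < r.stem.length,
    level m (i + 1) ≤ r.stem[q.stem.length + i]
  have hPk : P (z₁ n - q.stem.length) := by
    have hle : z₁ n - q.stem.length + 1 ≤ m + 1 := by omega
    refine ⟨by omega, ((hlevelMono m hle).trans hΛM).trans (hsorted _ _ _ (by omega))⟩
  have hex : ∃ i, P i := ⟨_, hPk⟩
  obtain ⟨hj, hgap⟩ := Nat.find_spec hex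
  have hik : Nat.find hex ≤ z₁ n - q.stem.length := Nat.find_min' hex hPk
  have hmin : ∀ i < Nat.find hex, ¬ P i := fun i => Nat.find_min hex
  generalize Nat.find hex = i₀ at hj hgap hik hmin
  have htake : q.StemBelow (r.stem.take (q.stem.length + i₀)) := by
    refine hrq.of_prefix ?_ (List.take_prefix _ _)
    rw [List.prefix_take_iff]
    exact ⟨hr.1, Nat.le_add_right _ _⟩
  have hlen : (r.stem.take (q.stem.length + i₀)).length = q.stem.length + i₀ := by
    rw [List.length_take]
    omega
  have hent : ∀ x ∈ r.stem.take (q.stem.length + i₀), x ≤ level m i₀ := by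
    intro x hx
    obtain ⟨i, hi, rfl⟩ := List.getElem_of_mem hx
    rw [List.getElem_take]
    rw [hlen] at hi
    rcases lt_or_ge i q.stem.length with hiq | hiq
    · rw [← hr.1.getElem hiq]
      exact (hA _ (by simp)).trans (hlevelMono m (Nat.zero_le i₀))
    · obtain ⟨i, rfl⟩ := Nat.exists_eq_add_of_le hiq
      have hlt : r.stem[q.stem.length + i] < level m (i + 1) := by
        by_contra h
        exact hmin i (by omega) ⟨by omega, not_lt.1 h⟩
      have hii : i + 1 ≤ i₀ := by omega
      exact hlt.le.trans (hlevelMono m hii)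
  have hFt := hF _ n m (hU _ n hUk _ htake (by omega))
  have hcomp : ∀ i (h : i < r.stem.length), q.stem.length + i₀ ≤ i →
      (F (r.stem.take (q.stem.length + i₀)) n m).commitment i ≤ r.stem[i] := by
    intro i hi hji
    rcases le_or_gt i (m + level m i₀) with him | him
    · refine (hG m (level m i₀) _ ⟨by omega, hent⟩ n hnm i him).trans ?_
      exact ((le_max_right _ _).trans hgap).trans (hsorted _ _ _ hji)
    · refine (hfF i _ ⟨by omega, fun x hx => (hent x hx).trans (by omega)⟩ n (by omega) m
        (by omega)).trans (hrf i hi (by omega))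
  refine ⟨r.raise _, r.raise_le _, hR (Dnd.raise_le_of_stem ?_ fun i hi hji => ?_) le_rfl hFt.2⟩
  · rw [hFt.1]
    exact List.take_prefix _ _
  · exact hcomp i hi (by rwa [hFt.1, hlen] at hji)

end Core

/-! ### Sets of the ground model -/

lemma ofNat_mem_ofNat {a b : ℕ} : PSet.ofNat.{u} a ∈ PSet.ofNat.{u} b ↔ a < b := by
  have hlt : ∀ {a b : ℕ}, a < b → PSet.ofNat.{u} a ∈ PSet.ofNat.{u} b := by
    intro a b h
    induction h with
    | refl => exact PSet.mem_insert _ _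
    | step _ ih => exact PSet.mem_insert_of_mem _ ih
  refine ⟨fun h => ?_, hlt⟩
  rcases lt_trichotomy a b with hab | rfl | hab
  · exact hab
  · exact absurd h (PSet.mem_irrefl _)
  · exact absurd h (PSet.mem_asymm (hlt hab))

lemma ofNat_equiv_ofNat {a b : ℕ} :
    PSet.Equiv (PSet.ofNat.{u} a) (PSet.ofNat.{u} b) ↔ a = b := by
  refine ⟨fun h => ?_, fun h => h ▸ PSet.Equiv.rfl⟩
  rcases lt_trichotomy a b with hab | hab | hab
  · exact absurd ((PSet.Mem.congr_left h).1 (ofNat_mem_ofNat.2 hab)) (PSet.mem_irrefl _)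
  · exact hab
  · exact absurd ((PSet.Mem.congr_left h).2 (ofNat_mem_ofNat.2 hab)) (PSet.mem_irrefl _)

lemma groundPair_equiv {x y x' y' : PSet.{u}} :
    PSet.Equiv (groundPair x y) (groundPair x' y') ↔ PSet.Equiv x x' ∧ PSet.Equiv y y' := by
  have h : ∀ a b : PSet.{u}, ZFSet.mk (groundPair a b) = ZFSet.pair (ZFSet.mk a) (ZFSet.mk b) :=
    fun _ _ => rfl
  rw [← ZFSet.eq, ← ZFSet.eq, ← ZFSet.eq, h, h, ZFSet.pair_inj]

lemma groundPair_mem_groundGraph {f : ℕ → ℕ} {a b : ℕ} :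
    groundPair (PSet.ofNat.{u} a) (PSet.ofNat b) ∈ groundGraph.{u} f ↔ f a = b := by
  constructor
  · rintro ⟨⟨k⟩, h⟩
    obtain ⟨h₁, h₂⟩ := groundPair_equiv.1 h
    rw [ofNat_equiv_ofNat] at h₁ h₂
    rw [h₁, h₂]
  · rintro rfl
    exact ⟨⟨a⟩, PSet.Equiv.rfl⟩

lemma groundGraph_mem_groundSet {S : Set (ℕ → ℕ)} {f : ℕ → ℕ} (hf : f ∈ S) :
    groundGraph.{u} f ∈ groundSet.{u} S := ⟨⟨⟨f, hf⟩⟩, PSet.Equiv.rfl⟩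

section Language

/-! ### Density, equality and membership -/

variable {P : Type v} [Preorder P]

lemma DenseBelow.mono {p q : P} {D : P → Prop} (h : DenseBelow p D) (hq : q ≤ p) :
    DenseBelow q D := fun r hr => h r (hr.trans hq)

lemma DenseBelow.imp {p : P} {D E : P → Prop} (h : DenseBelow p D) (hDE : ∀ q ≤ p, D q → E q) :
    DenseBelow p E := fun q hq =>
  let ⟨r, hr, hD⟩ := h q hq
  ⟨r, hr, hDE r (hr.trans hq) hD⟩

lemma DenseBelow.bind {p : P} {D E : P → Prop} (h : DenseBelow p D)
    (hDE : ∀ q ≤ p, D q → DenseBelow q E) : DenseBelow p E := fun q hq =>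
  let ⟨r, hr, hD⟩ := h q hq
  let ⟨r', hr', hE⟩ := hDE r (hr.trans hq) hD r le_rfl
  ⟨r', hr'.trans hr, hE⟩

lemma DenseBelow.of_forall {p : P} {D : P → Prop} (h : ∀ q ≤ p, D q) : DenseBelow p D :=
  fun q hq => ⟨q, le_rfl, h q hq⟩

lemma DenseBelow.const {p : P} {a : Prop} (h : DenseBelow p fun _ => a) : a :=
  let ⟨_, _, ha⟩ := h p le_rfl
  ha

lemma eqN_mk {ι κ : Type u} {x : ι → Name.{u} P} {s : ι → P} {y : κ → Name.{u} P} {t : κ → P}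
    {p : P} : eqN (.mk ι x s) (.mk κ y t) p ↔
      (∀ i, ∀ q ≤ p, q ≤ s i → DenseBelow q fun r => ∃ j, r ≤ t j ∧ eqN (x i) (y j) r) ∧
      (∀ j, ∀ q ≤ p, q ≤ t j → DenseBelow q fun r => ∃ i, r ≤ s i ∧ eqN (x i) (y j) r) := by
  rw [eqN]

lemma memN_mk {ι : Type u} {x : Name.{u} P} {y : ι → Name.{u} P} {t : ι → P} {p : P} :
    memN x (.mk ι y t) p ↔ DenseBelow p fun r => ∃ j, r ≤ t j ∧ eqN x (y j) r := Iff.rfl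

lemma eqN_mono {x y : Name.{u} P} {p q : P} (h : eqN x y p) (hq : q ≤ p) : eqN x y q := by
  cases x; cases y
  rw [eqN_mk] at h ⊢
  exact ⟨fun i r hr => h.1 i r (hr.trans hq), fun j r hr => h.2 j r (hr.trans hq)⟩

lemma eqN_of_dense {x y : Name.{u} P} {p : P} (h : DenseBelow p (eqN x y)) : eqN x y p := by
  cases x; cases y
  rw [eqN_mk]
  refine ⟨fun i q hq hqi => ?_, fun j q hq hqj => ?_⟩
  · exact (h.mono hq).bind fun r hr hxy => (eqN_mk.1 hxy).1 i r le_rfl (hr.trans hqi)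
  · exact (h.mono hq).bind fun r hr hxy => (eqN_mk.1 hxy).2 j r le_rfl (hr.trans hqj)

lemma eqN_refl (x : Name.{u} P) : ∀ p, eqN x x p := by
  induction x with
  | mk ι x s ih =>
    intro p
    rw [eqN_mk]
    exact ⟨fun i q _ hqi => .of_forall fun r hr => ⟨i, hr.trans hqi, ih i r⟩,
      fun i q _ hqi => .of_forall fun r hr => ⟨i, hr.trans hqi, ih i r⟩⟩

lemma eqN_symm {x : Name.{u} P} : ∀ {y : Name.{u} P} {p : P}, eqN x y p → eqN y x p := by
  induction x with
  | mk ι x s ih =>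
    rintro ⟨κ, y, t⟩ p h
    rw [eqN_mk] at h ⊢
    exact ⟨fun j q hq hqj => (h.2 j q hq hqj).imp fun r _ ⟨i, hi, e⟩ => ⟨i, hi, ih i e⟩,
      fun i q hq hqi => (h.1 i q hq hqi).imp fun r _ ⟨j, hj, e⟩ => ⟨j, hj, ih i e⟩⟩

lemma eqN_trans {x : Name.{u} P} :
    ∀ {y z : Name.{u} P} {p : P}, eqN x y p → eqN y z p → eqN x z p := by
  induction x with
  | mk ι x s ih =>
    rintro ⟨κ, y, t⟩ ⟨μ, z, w⟩ p hxy hyz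
    rw [eqN_mk] at hxy hyz ⊢
    refine ⟨fun i q hq hqi => ?_, fun k q hq hqk => ?_⟩
    · refine (hxy.1 i q hq hqi).bind fun r hr ⟨j, hj, e⟩ => ?_
      exact (hyz.1 j r (hr.trans hq) hj).imp fun r' hr' ⟨k, hk, e'⟩ =>
        ⟨k, hk, ih i (eqN_mono e hr') e'⟩
    · refine (hyz.2 k q hq hqk).bind fun r hr ⟨j, hj, e⟩ => ?_
      exact (hxy.2 j r (hr.trans hq) hj).imp fun r' hr' ⟨i, hi, e'⟩ =>
        ⟨i, hi, ih i e' (eqN_mono e hr')⟩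

lemma memN_mono {x y : Name.{u} P} {p q : P} (h : memN x y p) (hq : q ≤ p) : memN x y q := by
  cases y
  exact DenseBelow.mono h hq

lemma memN_congr_left {x x' y : Name.{u} P} {p : P} (e : eqN x x' p) (h : memN x y p) :
    memN x' y p := by
  cases y
  exact DenseBelow.imp h fun r hr ⟨j, hj, e'⟩ => ⟨j, hj, eqN_trans (eqN_symm (eqN_mono e hr)) e'⟩

lemma memN_congr_right {x y y' : Name.{u} P} {p : P} (e : eqN y y' p) (h : memN x y p) :
    memN x y' p := by
  cases y; cases y'
  rw [eqN_mk] at e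
  exact DenseBelow.bind h fun r hr ⟨j, hj, e'⟩ => (e.1 j r hr hj).imp fun r' hr' ⟨k, hk, e''⟩ =>
    ⟨k, hk, eqN_trans (eqN_mono e' hr') e''⟩

/-- Extensionality in the extension. -/
lemma eqN_of_memN_iff {x y : Name.{u} P} {p : P} (h : ∀ z, ∀ q ≤ p, memN z x q ↔ memN z y q) :
    eqN x y p := by
  rcases x with ⟨ι, x, s⟩
  rcases y with ⟨κ, y, t⟩
  rw [eqN_mk]
  refine ⟨fun i q hq hqi => ?_, fun j q hq hqj => ?_⟩
  · exact (h (x i) q hq).1 (.of_forall fun r hr => ⟨i, hr.trans hqi, eqN_refl _ _⟩)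
  · exact DenseBelow.imp ((h (y j) q hq).2 (.of_forall fun r hr => ⟨j, hr.trans hqj, eqN_refl _ _⟩))
      fun r _ ⟨i, hi, e⟩ => ⟨i, hi, eqN_symm e⟩

/-- A binary relation of the forcing language that persists to stronger conditions and respects
the equality of names. -/
structure IsRel (R : Name.{u} P → Name.{u} P → Sentence P) : Prop where
  mono : ∀ {n m : Name.{u} P} {p q : P}, R n m p → q ≤ p → R n m q
  congr : ∀ {n n' m m' : Name.{u} P} {p : P}, eqN n n' p → eqN m m' p → R n m p → R n' m' p

lemma isRel_leN : IsRel (leN (P := P)) where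
  mono h hq := DenseBelow.mono h hq
  congr hn hm h := DenseBelow.imp h fun _ hq h => h.imp
    (fun h => memN_congr_left (eqN_mono hn hq) (memN_congr_right (eqN_mono hm hq) h))
    fun h => eqN_trans (eqN_symm (eqN_mono hn hq)) (eqN_trans h (eqN_mono hm hq))

variable [OrderTop P]

lemma memN_upair {z x y : Name.{u} P} {p : P} :
    memN z (upair x y) p ↔ DenseBelow p fun q => eqN z x q ∨ eqN z y q := by
  refine ⟨fun h => DenseBelow.imp h ?_, fun h => DenseBelow.imp h ?_⟩
  · rintro q - ⟨⟨b⟩, -, e⟩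
    cases b
    · exact .inr e
    · exact .inl e
  · rintro q - (e | e)
    · exact ⟨⟨true⟩, le_top, e⟩
    · exact ⟨⟨false⟩, le_top, e⟩

lemma upair_congr {x x' y y' : Name.{u} P} {p : P} (hx : eqN x x' p) (hy : eqN y y' p) :
    eqN (upair x y) (upair x' y') p := by
  refine eqN_of_memN_iff fun z q hq => ?_
  rw [memN_upair, memN_upair]
  constructor
  · exact fun h => h.imp fun r hr e => e.imp (fun e => eqN_trans e (eqN_mono hx (hr.trans hq)))
      fun e => eqN_trans e (eqN_mono hy (hr.trans hq))
  · exact fun h => h.imp fun r hr e => e.imp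
      (fun e => eqN_trans e (eqN_symm (eqN_mono hx (hr.trans hq))))
      fun e => eqN_trans e (eqN_symm (eqN_mono hy (hr.trans hq)))

lemma opair_congr {x x' y y' : Name.{u} P} {p : P} (hx : eqN x x' p) (hy : eqN y y' p) :
    eqN (opair x y) (opair x' y') p :=
  upair_congr (upair_congr hx hx) (upair_congr hx hy)

/-! ### Canonical names -/

lemma eqN_check {x : PSet.{u}} : ∀ {y : PSet.{u}} {p : P},
    eqN (check x) (check y) p ↔ PSet.Equiv x y := by
  induction x with
  | mk ι x ih =>
    rintro ⟨κ, y⟩ p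
    rw [check, check, eqN_mk]
    constructor
    · intro h
      exact ⟨fun i => ((h.1 i p le_rfl le_top).imp fun q _ ⟨j, _, e⟩ => ⟨j, (ih i).1 e⟩).const,
        fun j => ((h.2 j p le_rfl le_top).imp fun q _ ⟨i, _, e⟩ => ⟨i, (ih i).1 e⟩).const⟩
    · intro h
      exact ⟨fun i q _ _ => .of_forall fun r _ => let ⟨j, e⟩ := h.1 i; ⟨j, le_top, (ih i).2 e⟩,
        fun j q _ _ => .of_forall fun r _ => let ⟨i, e⟩ := h.2 j; ⟨i, le_top, (ih i).2 e⟩⟩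

/-- The elements of a set of the ground model in the extension are its elements in the ground
model. -/
lemma memN_check_right {z : Name.{u} P} {x : PSet.{u}} {p : P} :
    memN z (check x) p ↔ DenseBelow p fun q => ∃ w ∈ x, eqN z (check w) q := by
  rcases x with ⟨ι, x⟩
  rw [check, memN_mk]
  refine ⟨fun h => h.imp fun q _ ⟨i, _, e⟩ => ⟨x i, PSet.Mem.mk x i, e⟩,
    fun h => h.imp fun q _ ⟨w, ⟨i, hi⟩, e⟩ => ⟨i, le_top, eqN_trans e (eqN_check.2 hi)⟩⟩

lemma memN_check {x y : PSet.{u}} {p : P} : memN (check x) (check y) p ↔ x ∈ y := by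
  rw [memN_check_right]
  simp only [eqN_check]
  refine ⟨fun h => ?_, fun h => .of_forall fun _ _ => ⟨x, h, PSet.Equiv.rfl⟩⟩
  obtain ⟨w, hw, e⟩ := h.const
  exact (PSet.Mem.congr_left e).2 hw

lemma check_pair (x y : PSet.{u}) (p : P) :
    eqN (check {x, y}) (upair (check x) (check y)) p := by
  refine eqN_of_memN_iff fun z q _ => ?_
  rw [memN_upair, memN_check_right]
  refine ⟨fun h => h.imp ?_, fun h => h.imp ?_⟩
  · rintro r - ⟨w, hw, e⟩
    exact (PSet.mem_pair.1 hw).imp (fun h => eqN_trans e (eqN_check.2 h))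
      fun h => eqN_trans e (eqN_check.2 h)
  · rintro r - (e | e)
    · exact ⟨x, PSet.mem_pair.2 (.inl PSet.Equiv.rfl), e⟩
    · exact ⟨y, PSet.mem_pair.2 (.inr PSet.Equiv.rfl), e⟩

lemma check_singleton (x : PSet.{u}) (p : P) :
    eqN (check {x}) (upair (check x) (check x)) p := by
  refine eqN_trans (eqN_check.2 ?_) (check_pair x x p)
  exact PSet.equiv_iff_mem.2 fun {w} => by simp

lemma check_groundPair (x y : PSet.{u}) (p : P) :
    eqN (check (groundPair x y)) (opair (check x) (check y)) p :=
  eqN_trans (check_pair _ _ p) (upair_congr (check_singleton x p) (check_pair x y p))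

/-! ### Natural numbers and relations between them -/

/-- The canonical name of the natural number `k`. -/
def natN (k : ℕ) : Name.{u} P := check (PSet.ofNat k)

lemma eqN_natN {a b : ℕ} {p : P} : eqN (natN.{u} a) (natN b) p ↔ a = b :=
  eqN_check.trans ofNat_equiv_ofNat

lemma memN_omega {x : Name.{u} P} {p : P} :
    memN x omega p ↔ DenseBelow p fun q => ∃ k, eqN x (natN k) q :=
  ⟨fun h => DenseBelow.imp h fun _ _ ⟨k, _, e⟩ => ⟨k.down, e⟩,
    fun h => DenseBelow.imp h fun _ _ ⟨k, e⟩ => ⟨⟨k⟩, le_top, e⟩⟩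

lemma natN_mem_omega (k : ℕ) (p : P) : memN (natN.{u} k) omega p :=
  memN_omega.2 (.of_forall fun _ _ => ⟨k, eqN_refl _ _⟩)

lemma check_groundPair_ofNat (a b : ℕ) (p : P) :
    eqN (check (groundPair (PSet.ofNat.{u} a) (PSet.ofNat b))) (opair (natN a) (natN b)) p :=
  check_groundPair _ _ p

lemma eqN_opair_natN {a b a' b' : ℕ} {p : P} :
    eqN (opair (natN.{u} a) (natN b)) (opair (natN a') (natN b')) p ↔ a = a' ∧ b = b' := by
  constructor
  · intro h
    have := eqN_check.1 (eqN_trans (check_groundPair_ofNat a b p)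
      (eqN_trans h (eqN_symm (check_groundPair_ofNat a' b' p))))
    rwa [groundPair_equiv, ofNat_equiv_ofNat, ofNat_equiv_ofNat] at this
  · rintro ⟨rfl, rfl⟩
    exact eqN_refl _ _

lemma leN_natN {a b : ℕ} {p : P} : leN (natN.{u} a) (natN b) p ↔ a ≤ b := by
  have : ∀ q : P, (memN (natN.{u} a) (natN b) q ∨ eqN (natN a) (natN b) q) ↔ a ≤ b := fun q => by
    rw [eqN_natN, natN, natN, memN_check, ofNat_mem_ofNat, le_iff_lt_or_eq]
  exact ⟨fun h => DenseBelow.const (DenseBelow.imp h fun q _ h => (this q).1 h),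
    fun h => DenseBelow.of_forall fun q _ => (this q).2 h⟩

lemma isRel_graph (y : Name.{u} P) : IsRel (graph y) where
  mono h hq := memN_mono h hq
  congr hn hm h := memN_congr_left (opair_congr hn hm) h

lemma graph_check {f : ℕ → ℕ} {a b : ℕ} {p : P} :
    graph (check (groundGraph.{u} f)) (natN a) (natN b) p ↔ f a = b := by
  rw [← groundPair_mem_groundGraph.{u}, ← memN_check (p := p)]
  have e := check_groundPair_ofNat.{u} a b p
  exact ⟨memN_congr_left (eqN_symm e), memN_congr_left e⟩

lemma isRel_comp {R S : Name.{u} P → Name.{u} P → Sentence P} (hR : IsRel R) (hS : IsRel S) :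
    IsRel (comp R S) where
  mono h hq := DenseBelow.mono h hq
  congr hn hm h := DenseBelow.imp h fun _ hq ⟨k, hk, h₁, h₂⟩ =>
    ⟨k, hk, hS.congr (eqN_mono hn hq) (eqN_refl _ _) h₁,
      hR.congr (eqN_refl _ _) (eqN_mono hm hq) h₂⟩

lemma comp_intro {R S : Name.{u} P → Name.{u} P → Sentence P} (hR : IsRel R) (hS : IsRel S)
    {n m : Name.{u} P} {p : P} (k : ℕ) (h₁ : S n (natN k) p) (h₂ : R (natN k) m p) :
    comp R S n m p :=
  DenseBelow.of_forall fun q hq => ⟨natN k, natN_mem_omega k q, hS.mono h₁ hq, hR.mono h₂ hq⟩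

/-- The relation `R ≤* S` in terms of natural numbers of the ground model. -/
lemma leStar_iff {R S : Name.{u} P → Name.{u} P → Sentence P} (hR : IsRel R) (hS : IsRel S)
    {p : P} : leStar R S p ↔ DenseBelow p fun q => ∃ N : ℕ, ∀ n ≥ N, DenseBelow q fun r =>
      ∃ a b, a ≤ b ∧ R (natN n) (natN a) r ∧ S (natN n) (natN b) r := by
  constructor
  · intro h
    refine DenseBelow.bind h fun q _ ⟨x, hx, hall⟩ => ?_
    refine (memN_omega.1 hx).imp fun r hr ⟨N, hN⟩ => ⟨N, fun n hn => ?_⟩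
    have hle : leN x (natN n) r :=
      isRel_leN.congr (eqN_symm hN) (eqN_refl _ _) (leN_natN.2 hn)
    have hex := hall (natN n) r hr (natN_mem_omega n r) r le_rfl hle
    refine DenseBelow.bind hex fun q₁ _ ⟨a, ha, hb⟩ => ?_
    refine (memN_omega.1 ha).bind fun r₁ hr₁ ⟨i, hi⟩ => ?_
    refine (DenseBelow.mono hb hr₁).bind fun q₂ hq₂ ⟨b, hb, hRa, hSb, hab⟩ => ?_
    refine (memN_omega.1 hb).imp fun r₂ hr₂ ⟨j, hj⟩ => ?_
    have hi := eqN_mono hi (hr₂.trans hq₂)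
    exact ⟨i, j, leN_natN.1 (isRel_leN.congr hi hj (isRel_leN.mono hab hr₂)),
      hR.congr (eqN_refl _ _) hi (hR.mono hRa hr₂), hS.congr (eqN_refl _ _) hj (hS.mono hSb hr₂)⟩
  · intro h
    refine DenseBelow.imp h fun q _ ⟨N, hN⟩ => ⟨natN N, natN_mem_omega N q, ?_⟩
    intro n q₁ hq₁ hn q₂ hq₂ hle
    refine ((memN_omega.1 hn).mono hq₂).bind fun r hr ⟨k, hk⟩ => ?_
    have hNk : N ≤ k := leN_natN.1 (isRel_leN.congr (eqN_refl _ _) hk (isRel_leN.mono hle hr))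
    refine ((hN k hNk).mono (hr.trans (hq₂.trans hq₁))).imp fun r₁ hr₁ ⟨a, b, hab, ha, hb⟩ => ?_
    have hk' := eqN_symm (eqN_mono hk hr₁)
    refine ⟨natN a, natN_mem_omega a r₁, DenseBelow.of_forall fun r₂ hr₂ =>
      ⟨natN b, natN_mem_omega b r₂, ?_, ?_, leN_natN.2 hab⟩⟩
    · exact hR.mono (hR.congr hk' (eqN_refl _ _) ha) hr₂
    · exact hS.mono (hS.congr hk' (eqN_refl _ _) hb) hr₂

end Language

/-! ### The generic real -/

lemma getElem?_eq_some_of_prefix {α : Type*} {l l' : List α} (h : l <+: l') {i : ℕ}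
    {a : α} (hi : l[i]? = some a) : l'[i]? = some a := by
  obtain ⟨e, rfl⟩ := h
  rw [List.getElem?_append_left (List.getElem?_eq_some_iff.1 hi).1, hi]

namespace Dnd

/-- The condition `p` with one more value of the stem; the sum of the old values is a simple number
above all of them. -/
def snoc (p : Dnd) : Dnd where
  stem := p.stem ++ [p.stem.sum + p.commitment p.stem.length]
  nondecreasing := by
    refine List.pairwise_append.2 ⟨p.nondecreasing, List.pairwise_singleton _ _,
      fun a ha b hb => ?_⟩
    rw [List.mem_singleton.1 hb]
    exact (List.le_sum_of_mem ha).trans (Nat.le_add_right _ _)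
  commitment := p.commitment

lemma snoc_le (p : Dnd) : p.snoc ≤ p := by
  refine ⟨List.prefix_append _ _, fun _ => le_rfl, fun n hn hpn => ?_⟩
  have hn' : n = p.stem.length := by
    simp only [snoc, List.length_append, List.length_singleton] at hn
    omega
  subst hn'
  simp [snoc]

lemma exists_le_length (p : Dnd) (k : ℕ) : ∃ q ≤ p, k < q.stem.length := by
  induction k with
  | zero =>
    refine ⟨p.snoc, p.snoc_le, ?_⟩
    simp [snoc]
  | succ k ih =>
    obtain ⟨q, hq, hk⟩ := ih
    refine ⟨q.snoc, q.snoc_le.trans hq, ?_⟩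
    simpa [snoc] using hk

end Dnd

/-- The elements of `d` are the pairs `(a, b)` such that a stem in the generic filter takes the
value `b` at `a`. -/
lemma memN_hechlerReal {z : Name.{u} Dnd} {p : Dnd} :
    memN z hechlerReal p ↔ DenseBelow p fun q =>
      ∃ a b, q.stem[a]? = some b ∧ eqN z (opair (natN a) (natN b)) q := by
  constructor
  · intro h
    refine DenseBelow.imp h fun q _ ⟨⟨⟨⟨a, b, c⟩, hc⟩⟩, hqc, e⟩ => ⟨a, b, ?_, ?_⟩
    · exact getElem?_eq_some_of_prefix hqc.1 hc
    · exact eqN_trans e (check_groundPair_ofNat a b q)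
  · intro h
    exact DenseBelow.imp h fun q _ ⟨a, b, hab, e⟩ =>
      ⟨⟨⟨(a, b, q), hab⟩⟩, le_rfl, eqN_trans e (eqN_symm (check_groundPair_ofNat a b q))⟩

lemma graph_hechlerReal {a b : ℕ} {p : Dnd} :
    graph hechlerReal.{u} (natN a) (natN b) p ↔ DenseBelow p fun q => q.stem[a]? = some b := by
  refine memN_hechlerReal.trans ⟨fun h => h.imp ?_, fun h => h.imp ?_⟩
  · rintro q - ⟨a', b', h, e⟩
    obtain ⟨rfl, rfl⟩ := eqN_opair_natN.1 e
    exact h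
  · exact fun q _ h => ⟨a, b, h, eqN_refl _ _⟩

lemma graph_hechlerReal_getElem {q r : Dnd} (hq : q ≤ r) {a : ℕ} (h : a < r.stem.length) :
    graph hechlerReal.{u} (natN a) (natN r.stem[a]) q :=
  graph_hechlerReal.2 (.of_forall fun _ hr =>
    getElem?_eq_some_of_prefix (hr.trans hq).1 (List.getElem?_eq_getElem h))

lemma isReal_hechlerReal (p : Dnd) : isReal hechlerReal.{u} p := by
  refine ⟨fun z q _ hz => ?_, fun n q _ hn => ?_, ?_⟩
  · refine (memN_hechlerReal.1 hz).imp fun r _ ⟨a, b, _, e⟩ => ⟨natN a, natN_mem_omega a r, ?_⟩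
    exact .of_forall fun r' hr' => ⟨natN b, natN_mem_omega b r', eqN_mono e hr'⟩
  · refine (memN_omega.1 hn).bind fun r _ ⟨k, e⟩ q' hq' => ?_
    obtain ⟨r', hr', hk⟩ := q'.exists_le_length k
    refine ⟨r', hr', natN r'.stem[k], natN_mem_omega _ r', ?_⟩
    exact (isRel_graph _).congr (eqN_symm (eqN_mono e (hr'.trans hq'))) (eqN_refl _ _)
      (graph_hechlerReal_getElem le_rfl hk)
  · intro n q₀ _ hn m q₁ hq₁ hm m' q₂ hq₂ hm' q₃ hq₃ h q₄ hq₄ h'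
    refine eqN_of_dense ?_
    refine ((memN_omega.1 hn).mono (hq₄.trans (hq₃.trans (hq₂.trans hq₁)))).bind
      fun r₁ hr₁ ⟨a, ea⟩ => ?_
    refine ((memN_omega.1 hm).mono (hr₁.trans (hq₄.trans (hq₃.trans hq₂)))).bind
      fun r₂ hr₂ ⟨b, eb⟩ => ?_
    refine ((memN_omega.1 hm').mono (hr₂.trans (hr₁.trans (hq₄.trans hq₃)))).bind
      fun r₃ hr₃ ⟨b', eb'⟩ => ?_
    have ea := eqN_mono ea (hr₃.trans hr₂)
    have eb := eqN_mono eb hr₃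
    have h₁ := (isRel_graph _).congr ea eb
      (memN_mono h (hr₃.trans (hr₂.trans (hr₁.trans hq₄))))
    have h₂ := (isRel_graph _).congr ea eb' (memN_mono h' (hr₃.trans (hr₂.trans hr₁)))
    refine (graph_hechlerReal.1 h₁).bind fun r₄ hr₄ hb => ?_
    refine ((graph_hechlerReal.1 h₂).mono hr₄).imp fun r₅ hr₅ hb' => ?_
    have : b = b' := Option.some_injective _ ((getElem?_eq_some_of_prefix hr₅.1 hb).symm.trans hb')
    subst this
    exact eqN_trans (eqN_mono eb (hr₅.trans hr₄)) (eqN_symm (eqN_mono eb' (hr₅.trans hr₄)))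

/-- Raising the commitment by `h` makes all later values of `d` at least those of `h`. -/
lemma isDominating_hechlerReal (p : Dnd) : isDominating hechlerReal.{u} p := by
  refine ⟨isReal_hechlerReal p, fun f q _ hf => ?_⟩
  refine (leStar_iff (isRel_graph _) (isRel_graph _)).2 ?_
  refine (memN_check_right.1 hf).bind fun r _ ⟨w, ⟨⟨h, _⟩, hw⟩, e⟩ q' hq' => ?_
  have e : eqN f (check (groundGraph h)) r := eqN_trans e (eqN_check.2 hw)
  refine ⟨q'.raise h, q'.raise_le h, q'.stem.length, fun n hn r₁ hr₁ => ?_⟩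
  obtain ⟨r₂, hr₂, hlen⟩ := r₁.exists_le_length n
  have hle : r₂ ≤ q'.raise h := hr₂.trans hr₁
  refine ⟨r₂, hr₂, h n, r₂.stem[n], ?_, ?_, graph_hechlerReal_getElem le_rfl hlen⟩
  · exact (le_max_right _ _).trans (hle.2.2 n hlen hn)
  · exact memN_congr_right (eqN_symm (eqN_mono e (hle.trans ((q'.raise_le h).trans hq'))))
      (graph_check.2 rfl)

lemma precN_hechlerReal {y : Name.{u} Dnd} {p : Dnd} (hy : isDominating y p) :
    precN hechlerReal y p := by
  intro p₁ hp₁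
  -- `q` forces `m ≤ y(n)`
  let R : Dnd → ℕ → ℕ → Prop := fun q n m =>
    DenseBelow q fun r => ∃ b ≥ m, graph y (natN n) (natN b) r
  obtain ⟨q, hq, z₀, hz₀, z₁, hz₁, N, hN⟩ := exists_climbing_bound (R := R)
    (fun hq hm h => (h.mono hq).imp fun _ _ ⟨b, hb, hg⟩ => ⟨b, hm.trans hb, hg⟩) p₁ (by
      intro g
      have hg : leStar (graph (check (groundGraph g))) (graph y) p₁ :=
        hy.2 _ p₁ hp₁ (memN_check.2 (groundGraph_mem_groundSet (Set.mem_univ g)))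
      obtain ⟨q, hq, N, hN⟩ := (leStar_iff (isRel_graph _) (isRel_graph _)).1 hg p₁ le_rfl
      refine ⟨q, hq, N, fun n hn => (hN n hn).imp fun r _ ⟨a, b, hab, ha, hb⟩ => ⟨b, ?_, hb⟩⟩
      rwa [graph_check.1 ha])
  have hrel : IsRel (comp (graph hechlerReal.{u}) (graph (check (groundGraph z₁)))) :=
    isRel_comp (isRel_graph _) (isRel_graph _)
  refine ⟨q, hq, _, memN_check.2 (groundGraph_mem_groundSet hz₀), .of_forall fun q' hq' =>
    ⟨_, memN_check.2 (groundGraph_mem_groundSet hz₁), ?_⟩⟩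
  refine (leStar_iff (isRel_comp (isRel_graph _) hrel) (isRel_graph _)).2
    (.of_forall fun q₁ hq₁ => ⟨N, fun n hn r hr => ?_⟩)
  obtain ⟨r₁, hr₁, hlen⟩ := r.exists_le_length (z₁ n)
  obtain ⟨r₂, hr₂, hR⟩ := hN n hn r₁ (hr₁.trans (hr.trans (hq₁.trans hq'))) hlen
  obtain ⟨r₃, hr₃, b, hb, hg⟩ := hR r₂ le_rfl
  refine ⟨r₃, hr₃.trans (hr₂.trans hr₁), z₀ r₁.stem[z₁ n], b, hb, ?_, hg⟩
  refine comp_intro (isRel_graph _) hrel r₁.stem[z₁ n] ?_ (graph_check.2 rfl)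
  exact comp_intro (isRel_graph _) (isRel_graph _) (z₁ n) (graph_check.2 rfl)
    (graph_hechlerReal_getElem (hr₃.trans hr₂) hlen)

end Forcing

open Forcing
/-- In every extension `V[d]` of `V` by a generic real `d` for nondecreasing Hechler forcing, `d` is
a dominating real, and `d ⪯ y` for every dominating real `y ∈ V[d]`. -/
theorem theorem3 (p : Dnd) :
    p ⊩ isDominating hechlerReal.{u} ∧ₙ
      allN fun y : Name.{u} Dnd => isDominating y →ₙ precN hechlerReal y :=
  ⟨isDominating_hechlerReal p, fun _ _ _ hy => precN_hechlerReal hy⟩
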